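/- **Theorem.** Let $K$ be an algebraically closed field, let $X$ be an affine variety over $K$ (a Zariski-closed subset of some $K^m$, with coordinate ring $K[X]$), and let $G$ be a finite group acting on $X$ by automorphisms of the variety. Let $K[X]^G=\{f\in K[X] \mid f(\sigma x)=f(x)\text{ for all }\sigma\in G,\ x\in X\}$ be the invariant ring, put $R := K[X]\otimes_K K[X]$, and let $$I := \bigl(f\otimes 1-1\otimes f \;\bigm|\; f\in K[X]^G\bigr)\subseteq R .$$ For a noetherian ring $A$ define the Cohen–Macaulay defect by $$\operatorname{cmdef}(A) := \sup\{\dim(A_{\mathfrak p})-\operatorname{depth}(A_{\mathfrak p}) \mid \mathfrak p\in\operatorname{Spec}(A)\}\in\mathbb N_0\cup\{\infty\}.$$ For $j\in\mathbb N_0$, an element $\sigma\in G$ is called a $j$-reflection if its fixed locus $X^\sigma=\{x\in X\mid \sigma x=x\}$ has codimension at most $j$ in $X$; here the codimension of a closed set $Z\subseteq X$ is the infimum, over the irreducible closed subsets $W\subseteq Z$, of the supremum of the lengths $r$ of chains $W=W_0\subsetneq W_1\subsetneq\dots\subsetneq W_r$ of irreducible closed subsets of $X$ (so the empty set has codimension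 $\infty$). Assume that $X$ is connected in the Zariski topology and that $G$ is generated by elements having a fixed point in $X$. Then the minimum $$k := \min\{\operatorname{cmdef}(R/J) \mid J\subseteq R \text{ an ideal with } \sqrt J=\sqrt I\}$$ is finite, and $G$ is generated by $(k+1)$-reflections. -/

import Mathlib

open scoped TensorProduct

universe u v

noncomputable section

/-! ### Affine varieties, regular functions, regular maps -/

/-- The affine variety `V(𝔞) ⊆ Kᵐ` (a set of points) cut out by an ideal `𝔞` of `K[x₁, …, xₘ]`. -/
def AffineVariety {K : Type u} [Field K] {m : ℕ} (𝔞 : Ideal (MvPolynomial (Fin m) K)) : Type u :=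
  {x : Fin m → K // x ∈ MvPolynomial.zeroLocus K 𝔞}

namespace AffineVariety

variable {K : Type u} [Field K] {m : ℕ}

/-- The common zeros in `V(𝔞)` of a set of polynomials. -/
def zeros (𝔞 : Ideal (MvPolynomial (Fin m) K)) (S : Set (MvPolynomial (Fin m) K)) :
    Set (AffineVariety 𝔞) :=
  {x | ∀ p ∈ S, MvPolynomial.eval x.1 p = 0}

/-- The Zariski topology on `V(𝔞)`: the closed sets are the zero sets of polynomials. -/
instance zariskiTopology (𝔞 : Ideal (MvPolynomial (Fin m) K)) :
    TopologicalSpace (AffineVariety 𝔞) :=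
  TopologicalSpace.ofClosed {Z | ∃ S : Set (MvPolynomial (Fin m) K), Z = zeros 𝔞 S}
    ⟨{1}, by
      ext x
      simp [zeros]⟩
    (by
      intro A hA
      refine ⟨{p | ∃ S, zeros 𝔞 S ∈ A ∧ p ∈ S}, ?_⟩
      ext x
      constructor
      · rintro hx p ⟨S, hS, hp⟩
        exact hx _ hS p hp
      · intro hx Z hZ
        obtain ⟨S, rfl⟩ := hA hZ
        exact fun p hp => hx p ⟨S, hZ, hp⟩)
    (by
      rintro _ ⟨S, rfl⟩ _ ⟨T, rfl⟩
      refine ⟨{r | ∃ p ∈ S, ∃ q ∈ T, r = p * q}, ?_⟩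
      ext x
      constructor
      · rintro (hx | hx) _ ⟨p, hp, q, hq, rfl⟩
        · simp [hx p hp]
        · simp [hx q hq]
      · intro hx
        by_contra hcon
        simp only [zeros, Set.mem_union, Set.mem_ofPred_eq, not_or, not_forall] at hcon
        obtain ⟨⟨p, hp, hp0⟩, q, hq, hq0⟩ := hcon
        have := hx _ ⟨p, hp, q, hq, rfl⟩
        rw [map_mul] at this
        exact (mul_ne_zero hp0 hq0) this)

/-- The `K`-algebra of all functions `X → K` on `X = V(𝔞)` that are given by polynomials. -/
def regularFunctions (𝔞 : Ideal (MvPolynomial (Fin m) K)) :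
    Subalgebra K (AffineVariety 𝔞 → K) :=
  (AlgHom.pi fun x : AffineVariety 𝔞 =>
    (MvPolynomial.aeval x.1 : MvPolynomial (Fin m) K →ₐ[K] K)).range

/-- The coordinate ring `K[X]` of `X = V(𝔞)`, i.e. the algebra of regular functions on `X`. -/
def CoordinateRing (𝔞 : Ideal (MvPolynomial (Fin m) K)) : Type u :=
  regularFunctions 𝔞

instance (𝔞 : Ideal (MvPolynomial (Fin m) K)) : CommRing (CoordinateRing 𝔞) :=
  inferInstanceAs (CommRing (regularFunctions 𝔞))

instance (𝔞 : Ideal (MvPolynomial (Fin m) K)) : Algebra K (CoordinateRing 𝔞) :=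
  inferInstanceAs (Algebra K (regularFunctions 𝔞))

/-- A map between affine varieties is regular if its coordinates are given by polynomials. -/
def IsRegularMap {n : ℕ} {𝔞 : Ideal (MvPolynomial (Fin m) K)}
    {𝔟 : Ideal (MvPolynomial (Fin n) K)} (φ : AffineVariety 𝔞 → AffineVariety 𝔟) : Prop :=
  ∃ P : Fin n → MvPolynomial (Fin m) K, ∀ x i, (φ x).1 i = MvPolynomial.eval x.1 (P i)

/-! ### Group actions on affine varieties -/

variable (G : Type v) [Group G] (𝔞 : Ideal (MvPolynomial (Fin m) K))
  [MulAction G (AffineVariety 𝔞)]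

/-- The invariant ring `K[X]^G`. -/
def invariantRing : Subalgebra K (CoordinateRing 𝔞) where
  carrier := {f | ∀ (σ : G) (x : AffineVariety 𝔞), f.1 (σ • x) = f.1 x}
  mul_mem' := fun {f g} hf hg σ x => by
    change f.1 (σ • x) * g.1 (σ • x) = f.1 x * g.1 x
    rw [hf, hg]
  add_mem' := fun {f g} hf hg σ x => by
    change f.1 (σ • x) + g.1 (σ • x) = f.1 x + g.1 x
    rw [hf, hg]
  algebraMap_mem' := fun _ _ _ => rfl

/-- The ideal `I = (f ⊗ 1 - 1 ⊗ f | f ∈ K[X]^G)` of `K[X] ⊗ K[X]`. -/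
def separatingIdeal : Ideal (CoordinateRing 𝔞 ⊗[K] CoordinateRing 𝔞) :=
  Ideal.span {t | ∃ f ∈ invariantRing G 𝔞, t = f ⊗ₜ[K] 1 - 1 ⊗ₜ[K] f}

end AffineVariety

/-! ### Codimension and reflections -/

/-- The codimension in `Y` of a closed subset `Z`: the infimum, over the irreducible closed subsets
`W` of `Z`, of the suprema of the lengths of chains `W = W₀ ⊂ W₁ ⊂ ⋯` of irreducible closed subsets
of `Y`. The empty set has codimension `∞`. -/
def topologicalCodim {Y : Type u} [TopologicalSpace Y] (Z : Set Y) : ℕ∞ :=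
  ⨅ (W : TopologicalSpace.IrreducibleCloseds Y) (_ : (W : Set Y) ⊆ Z), Order.coheight W

/-- `σ` is a `k`-reflection on `Y` if its fixed locus has codimension at most `k` in `Y`. -/
def IsKReflection {G : Type v} [Group G] (Y : Type u) [TopologicalSpace Y] [MulAction G Y]
    (k : ℕ) (σ : G) : Prop :=
  topologicalCodim (MulAction.fixedBy Y σ) ≤ k

/-! ### The Cohen-Macaulay defect -/

/-- The depth of a (noetherian) local ring: the supremum of the lengths of the regular sequences
contained in the maximal ideal. -/
def localDepth (A : Type u) [CommRing A] [IsLocalRing A] : ℕ∞ :=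
  ⨆ (rs : List A) (_ : RingTheory.Sequence.IsRegular A rs ∧ ∀ r ∈ rs, r ∈ IsLocalRing.maximalIdeal A),
    (rs.length : ℕ∞)

/-- `dim A - depth A` for a noetherian local ring `A`. Here `0 ≤ depth A ≤ dim A < ∞`, so neither
the default value of `unbotD` nor the truncation of the subtraction intervenes. -/
def localCMDefect (A : Type u) [CommRing A] [IsLocalRing A] : ℕ∞ :=
  (ringKrullDim A).unbotD 0 - localDepth A

/-- The Cohen-Macaulay defect of a noetherian ring: the supremum of the defects of its
localizations at prime ideals. -/
def cmDefect (A : Type u) [CommRing A] : ℕ∞ :=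
  ⨆ 𝔭 : PrimeSpectrum A, localCMDefect (Localization.AtPrime 𝔭.asIdeal)

/-- The set of all `cmdef(A/J)`, where `J` runs through the ideals of `A` with the same radical
as `I`. Its minimum is the set-theoretical Cohen-Macaulay defect of `A/I`. -/
def cmDefectsUpToRadical {A : Type u} [CommRing A] (I : Ideal A) : Set ℕ∞ :=
  {d | ∃ J : Ideal A, J.radical = I.radical ∧ d = cmDefect (A ⧸ J)}

end

/-! ### Hartshorne's connectedness lemma -/

/-! Up to nilpotents, `Spec (R/J)` is the union of the graphs of the elements of `G`, each a copy of
`X` (`exists_ker_graphHom_le`). The graphs of `σ` and `τ` meet in a copy of the fixed locus of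
`σ⁻¹τ`, so if `σ⁻¹τ` is not a `(k + 1)`-reflection, every prime on both graphs has height at least
`k + 2` (`topologicalCodim_fixedBy_le`). When `cmdef (R/J) ≤ k`, the local ring there has depth at
least 2, and Hartshorne's lemma says that its punctured spectrum is connected
(`forall_prime_le_of_cmDefect_le`).

Let `N` be the subgroup generated by the `(k + 1)`-reflections, and let `ρ ∉ N` fix `x`. The graphs
over `N` and those over its complement form two closed sets which share the point `(x, x)`. At the
generic point of a component of their intersection they would disconnect the punctured spectrum, a
contradiction (`mem_of_cmDefect_le`). So `N` contains all elements with a fixed point, and these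
generate `G`. -/

lemma mem_span_of_pow_mul_mem {L : Type*} [CommRing L] {x y : L}
    (hy : ∀ a, y * a ∈ Ideal.span {x} → a ∈ Ideal.span {x}) (n : ℕ) {a : L}
    (h : y ^ n * a ∈ Ideal.span {x}) : a ∈ Ideal.span {x} := by
  induction n with
  | zero => simpa using h
  | succ n ih => exact ih (hy _ (by rwa [← mul_assoc, ← pow_succ']))

/-- A nonzerodivisor modulo `x` stays one modulo `x ^ n`: split off one factor `x`, cancel it by
regularity, and induct. -/
lemma mem_span_pow_of_mul_mem {L : Type*} [CommRing L] {x y : L} (hx : IsSMulRegular L x)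
    (hy : ∀ a, y * a ∈ Ideal.span {x} → a ∈ Ideal.span {x}) (n : ℕ) {a : L}
    (h : y * a ∈ Ideal.span {x ^ n}) : a ∈ Ideal.span {x ^ n} := by
  induction n generalizing a with
  | zero => simp
  | succ n ih =>
    obtain ⟨c, hc⟩ := Ideal.mem_span_singleton'.mp h
    obtain ⟨a', rfl⟩ := Ideal.mem_span_singleton'.mp
      (hy a (Ideal.mem_span_singleton'.mpr ⟨c * x ^ n, by rw [← hc]; ring⟩))
    have hcn : c * x ^ n = y * a' := hx (by simp only [smul_eq_mul]; linear_combination hc)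
    obtain ⟨d, rfl⟩ := Ideal.mem_span_singleton'.mp
      (ih (Ideal.mem_span_singleton'.mpr ⟨c, hcn⟩))
    exact Ideal.mem_span_singleton'.mpr ⟨d, by ring⟩

/-- In a local ring with a regular sequence `x, y`, ideals with product zero and `𝔪`-primary sum
are trivial. -/
lemma eq_bot_or_eq_bot_of_mul_eq_bot {L : Type*} [CommRing L] [IsLocalRing L] {x y : L}
    (hx : IsSMulRegular L x) (hy : ∀ a, y * a ∈ Ideal.span {x} → a ∈ Ideal.span {x})
    {a b : Ideal L} (hab : a * b = ⊥) (hxr : x ∈ (a ⊔ b).radical) (hyr : y ∈ (a ⊔ b).radical) :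
    a = ⊥ ∨ b = ⊥ := by
  obtain ⟨n, hn⟩ := hxr
  obtain ⟨l, hl⟩ := hyr
  obtain ⟨a₁, ha₁, b₁, hb₁, h₁⟩ := Submodule.mem_sup.mp hn
  obtain ⟨a₂, ha₂, b₂, hb₂, h₂⟩ := Submodule.mem_sup.mp hl
  have key : ∀ s ∈ a, ∀ t ∈ b, s * t = 0 := fun s hs t ht => by
    have := Ideal.mul_mem_mul hs ht
    rwa [hab] at this
  have hxn : IsSMulRegular L (x ^ n) := hx.pow n
  -- Since `ab = 0`, `y ^ l * a₁ = (a₂ + b₂) * a₁ = a₂ * a₁ = a₂ * (a₁ + b₁) = a₂ * x ^ n`; now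
  -- cancel `y ^ l` modulo `x ^ n`.
  have hmem : a₁ ∈ Ideal.span {x ^ n} := by
    refine mem_span_of_pow_mul_mem (fun c => mem_span_pow_of_mul_mem hx hy n) l ?_
    refine Ideal.mem_span_singleton'.mpr ⟨a₂, ?_⟩
    rw [← h₁, ← h₂]
    linear_combination key a₂ ha₂ b₁ hb₁ - key a₁ ha₁ b₂ hb₂
  obtain ⟨c, hc⟩ := Ideal.mem_span_singleton'.mp hmem
  have hrel : c * b₁ = (1 - c) * a₁ := by rw [← h₁] at hc; linear_combination hc
  -- Whichever of `c`, `1 - c` is a unit, the relation puts `x ^ n = a₁ + b₁` entirely into `a` or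
  -- into `b`; being regular and killing the other ideal, it forces that ideal to vanish.
  rcases IsLocalRing.isUnit_or_isUnit_one_sub_self c with hu | hu
  · right
    have hb₁a : b₁ ∈ a := (Ideal.unit_mul_mem_iff_mem a hu).mp (hrel ▸ a.mul_mem_left _ ha₁)
    refine (Submodule.eq_bot_iff _).mpr fun t ht => hxn ?_
    simp only [smul_eq_mul, mul_zero]
    exact key _ (h₁ ▸ a.add_mem ha₁ hb₁a) t ht
  · left
    have ha₁b : a₁ ∈ b := (Ideal.unit_mul_mem_iff_mem b hu).mp (hrel ▸ b.mul_mem_left _ hb₁)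
    refine (Submodule.eq_bot_iff _).mpr fun s hs => hxn ?_
    simp only [smul_eq_mul, mul_zero]
    rw [mul_comm]
    exact key s hs _ (h₁ ▸ b.add_mem ha₁b hb₁)

lemma exists_regular_pair_of_two_le_localDepth {L : Type u} [CommRing L] [IsLocalRing L]
    (h : 2 ≤ localDepth L) :
    ∃ x ∈ IsLocalRing.maximalIdeal L, ∃ y ∈ IsLocalRing.maximalIdeal L, IsSMulRegular L x ∧
      ∀ a, y * a ∈ Ideal.span {x} → a ∈ Ideal.span {x} := by
  have h1 : (1 : ℕ∞) < localDepth L := lt_of_lt_of_le (by norm_num) h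
  simp only [localDepth, lt_iSup_iff] at h1
  obtain ⟨rs, ⟨hreg, hmem⟩, hlen⟩ := h1
  match rs, hreg, hmem, hlen with
  | x :: y :: rs, hreg, hmem, _ =>
    rw [RingTheory.Sequence.isRegular_cons_iff, RingTheory.Sequence.isRegular_cons_iff] at hreg
    refine ⟨x, hmem x (by simp), y, hmem y (by simp), hreg.1, fun a ha => ?_⟩
    have := (isSMulRegular_quotient_iff_mem_of_smul_mem _ _).mp hreg.2.1 a
    simp only [smul_eq_mul, Submodule.mem_smul_pointwise_iff_exists, Submodule.mem_top,
      true_and] at this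
    obtain ⟨c, hc⟩ := Ideal.mem_span_singleton'.mp ha
    obtain ⟨d, hd⟩ := this ⟨c, by rw [mul_comm, hc]⟩
    exact Ideal.mem_span_singleton'.mpr ⟨d, by rw [mul_comm, hd]⟩
  | [_], _, _, hlen => simp at hlen
  | [], _, _, hlen => simp at hlen

/-- Hartshorne's connectedness lemma: the punctured spectrum of a noetherian local ring of depth at
least two is connected. -/
lemma le_nilradical_or_le_nilradical_of_two_le_localDepth {L : Type u} [CommRing L]
    [IsNoetherianRing L] [IsLocalRing L] (h : 2 ≤ localDepth L) {a b : Ideal L}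
    (hab : a * b ≤ nilradical L) (hm : IsLocalRing.maximalIdeal L ≤ (a ⊔ b).radical) :
    a ≤ nilradical L ∨ b ≤ nilradical L := by
  obtain ⟨x, hx, y, hy, hxr, hyr⟩ := exists_regular_pair_of_two_le_localDepth h
  obtain ⟨n, hn⟩ := Ideal.exists_pow_le_of_le_radical_of_fg hab (IsNoetherian.noetherian _)
  -- The exponent is raised to `n + 1` because taking radicals of powers needs a nonzero exponent.
  have hn' : (a * b) ^ (n + 1) ≤ ⊥ := (Ideal.pow_le_pow_right n.le_succ).trans hn
  have hrad : (a ^ (n + 1) ⊔ b ^ (n + 1)).radical = (a ⊔ b).radical := by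
    rw [Ideal.radical_sup, Ideal.radical_pow _ n.succ_ne_zero, Ideal.radical_pow _ n.succ_ne_zero,
      ← Ideal.radical_sup]
  have hpow : ∀ c : Ideal L, c ^ (n + 1) = ⊥ → c ≤ nilradical L := fun c hc t ht =>
    ⟨n + 1, by simpa [hc] using Ideal.pow_mem_pow ht (n + 1)⟩
  exact (eq_bot_or_eq_bot_of_mul_eq_bot hxr hyr (by rwa [← mul_pow, ← le_bot_iff])
    (hrad ▸ hm hx) (hrad ▸ hm hy)).imp (hpow a) (hpow b)

/-- A local form of Hartshorne's connectedness lemma in codimension `k + 1`. -/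
lemma forall_prime_le_of_cmDefect_le {S : Type u} [CommRing S] [IsNoetherianRing S] {k : ℕ}
    (hk : cmDefect S ≤ k) {a b p : Ideal S} (hab : a * b ≤ nilradical S)
    (hp : p ∈ (a ⊔ b).minimalPrimes) (hht : (k + 2 : ℕ) ≤ p.height) :
    (∀ q : Ideal S, q.IsPrime → q ≤ p → a ≤ q) ∨ ∀ q : Ideal S, q.IsPrime → q ≤ p → b ≤ q := by
  have hpp : p.IsPrime := hp.1.1
  let L := Localization.AtPrime p
  have : IsNoetherianRing L := IsLocalization.isNoetherianRing p.primeCompl L inferInstance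
  have hdepth : 2 ≤ localDepth L := by
    have h1 : localCMDefect L ≤ k :=
      (le_iSup (fun 𝔭 : PrimeSpectrum S => localCMDefect (Localization.AtPrime 𝔭.asIdeal))
        ⟨p, hpp⟩).trans hk
    rw [localCMDefect, IsLocalization.AtPrime.ringKrullDim_eq_height p L,
      WithBot.unbotD_coe, tsub_le_iff_right] at h1
    have h2 := hht.trans h1
    by_contra! h3
    have h4 : localDepth L ≤ 1 := ENat.lt_add_one_iff (by simp) |>.mp (by simpa [one_add_one_eq_two] using h3)
    have h5 : ((k + 2 : ℕ) : ℕ∞) ≤ ((k + 1 : ℕ) : ℕ∞) :=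
      h2.trans (by push_cast; gcongr)
    have := ENat.natCast_le_natCast.mp h5
    omega
  -- By minimality of `p`, the maximal ideal is the only prime of `L` above the extension of `a ⊔
  -- b`.
  have hm : IsLocalRing.maximalIdeal L ≤
      (a.map (algebraMap S L) ⊔ b.map (algebraMap S L)).radical := by
    rw [← Ideal.map_sup, Ideal.radical_eq_sInf]
    refine le_sInf fun Q ⟨hQ, hQp⟩ => ?_
    rw [← Localization.AtPrime.map_eq_maximalIdeal, Ideal.map_le_iff_le_comap]
    refine hp.2 ⟨hQp.comap _, Ideal.map_le_iff_le_comap.mp hQ⟩ ?_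
    exact (Ideal.comap_mono (IsLocalRing.le_maximalIdeal hQp.ne_top)).trans
      (IsLocalization.AtPrime.under_maximalIdeal L p).le
  have hnil : a.map (algebraMap S L) * b.map (algebraMap S L) ≤ nilradical L := by
    rw [← Ideal.map_mul, Ideal.map_le_iff_le_comap]
    exact fun t ht => IsNilpotent.map (r := t) (hab ht) (algebraMap S L)
  have key : ∀ c : Ideal S, c.map (algebraMap S L) ≤ nilradical L →
      ∀ q : Ideal S, q.IsPrime → q ≤ p → c ≤ q := by
    intro c hc q hq hqp t ht
    obtain ⟨n, hn⟩ : IsNilpotent (algebraMap S L t) := hc (Ideal.mem_map_of_mem _ ht)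
    rw [← map_pow, IsLocalization.map_eq_zero_iff p.primeCompl] at hn
    obtain ⟨s, hs⟩ := hn
    have := (hq.mem_or_mem (hs ▸ q.zero_mem : (s : S) * t ^ n ∈ q)).resolve_left
      fun h => s.2 (hqp h)
    exact hq.mem_of_pow_mem _ this
  exact (le_nilradical_or_le_nilradical_of_two_le_localDepth hdepth hnil hm).imp (key a) (key b)

/-! ### Finiteness of the Cohen-Macaulay defect -/

lemma cmDefect_le_of_ringKrullDim_le {A : Type u} [CommRing A] {n : ℕ}
    (h : ringKrullDim A ≤ n) : cmDefect A ≤ n := by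
  refine iSup_le fun 𝔭 => tsub_le_self.trans ?_
  have := (IsLocalization.AtPrime.ringKrullDim_eq_height 𝔭.asIdeal
    (Localization.AtPrime 𝔭.asIdeal))
  rw [this, WithBot.unbotD_coe]
  have h2 := (Ideal.height_le_ringKrullDim_of_ne_top 𝔭.2.ne_top).trans h
  exact_mod_cast h2

/-! ### Graph ideals -/

section Graph

variable {K A : Type*} [Field K] [CommRing A] [Algebra K A]

/-- The homomorphism `f ⊗ g ↦ f * θ g`, dual to the graph embedding `x ↦ (x, θ* x)`. -/
noncomputable def graphHom (θ : A →ₐ[K] A) : A ⊗[K] A →ₐ[K] A :=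
  Algebra.TensorProduct.productMap (AlgHom.id K A) θ

@[simp]
lemma graphHom_tmul (θ : A →ₐ[K] A) (f g : A) : graphHom θ (f ⊗ₜ g) = f * θ g := by
  simp [graphHom]

lemma graphHom_surjective (θ : A →ₐ[K] A) : Function.Surjective (graphHom θ) :=
  fun f => ⟨f ⊗ₜ 1, by simp⟩

/-- Modulo `p`, every tensor `r` is congruent to `graphHom θ r ⊗ 1`. -/
lemma ker_graphHom_le {θ : A →ₐ[K] A} {p : Ideal (A ⊗[K] A)}
    (h : ∀ g, 1 ⊗ₜ[K] g - θ g ⊗ₜ[K] 1 ∈ p) : RingHom.ker (graphHom θ) ≤ p := by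
  have key : ∀ r : A ⊗[K] A, r - graphHom θ r ⊗ₜ[K] 1 ∈ p := by
    intro r
    induction r with
    | zero => simp
    | tmul f g =>
      have : f ⊗ₜ[K] g - (f * θ g) ⊗ₜ[K] 1 = f ⊗ₜ[K] 1 * (1 ⊗ₜ[K] g - θ g ⊗ₜ[K] 1) := by
        simp [mul_sub]
      rw [graphHom_tmul, this]
      exact p.mul_mem_left _ (h g)
    | add r s hr hs =>
      rw [map_add, TensorProduct.add_tmul]
      convert p.add_mem hr hs using 1
      ring
  intro r hr
  have := key r
  rwa [RingHom.mem_ker.mp hr, TensorProduct.zero_tmul, sub_zero] at this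

/-- A prime containing all `f ⊗ 1 - 1 ⊗ f` with `f` invariant contains the ideal of the graph of
some group element. -/
lemma exists_ker_graphHom_le [Infinite K] {G : Type*} [Group G] [Finite G] {θ : G → A →ₐ[K] A}
    (hone : θ 1 = AlgHom.id K A) (hmul : ∀ σ τ g, θ τ (θ σ g) = θ (σ * τ) g)
    {p : Ideal (A ⊗[K] A)} [hp : p.IsPrime]
    (h : ∀ f, (∀ σ, θ σ f = f) → f ⊗ₜ[K] 1 - 1 ⊗ₜ[K] f ∈ p) :
    ∃ σ, RingHom.ker (graphHom (θ σ)) ≤ p := by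
  cases nonempty_fintype G
  let q : A ⊗[K] A →ₐ[K] (A ⊗[K] A) ⧸ p := Ideal.Quotient.mkₐ K p
  let i₁ : A →ₐ[K] (A ⊗[K] A) ⧸ p := q.comp Algebra.TensorProduct.includeLeft
  let i₂ : A →ₐ[K] (A ⊗[K] A) ⧸ p := q.comp Algebra.TensorProduct.includeRight
  have hinv : ∀ f, (∀ σ, θ σ f = f) → i₁ f = i₂ f := fun f hf =>
    Ideal.Quotient.eq.mpr (h f hf)
  have hroot : ∀ g, ∃ σ, i₂ g = i₁ (θ σ g) := by
    intro g
    -- The orbit polynomial of `g` has invariant coefficients, so `i₁` and `i₂` map it to the same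
    -- polynomial. It has `i₂ g` as a root and splits with roots `i₁ (θ σ g)` over a domain.
    let P : Polynomial A := ∏ σ, (Polynomial.X - Polynomial.C (θ σ g))
    have hP : ∀ τ, P.map (θ τ).toRingHom = P := by
      intro τ
      simp only [P, Polynomial.map_prod, Polynomial.map_sub, Polynomial.map_X, Polynomial.map_C]
      exact Fintype.prod_equiv (Equiv.mulRight τ) _ _ fun σ => by simp [hmul]
    have hP' : P.map i₁.toRingHom = P.map i₂.toRingHom := by
      ext n
      simp only [Polynomial.coeff_map]
      refine hinv _ fun τ => ?_
      conv_rhs => rw [← hP τ]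
      simp
    have h0 : P.eval g = 0 := by
      rw [Polynomial.eval_prod]
      exact Finset.prod_eq_zero (Finset.mem_univ 1) (by simp [hone])
    have h1 : (P.map i₁.toRingHom).eval (i₂ g) = 0 := by
      rw [hP']
      have := Polynomial.eval_map_apply (p := P) i₂.toRingHom g
      exact this.trans (by rw [h0, map_zero])
    simp only [P, Polynomial.map_prod, Polynomial.map_sub, Polynomial.map_X, Polynomial.map_C,
      Polynomial.eval_prod, Polynomial.eval_sub, Polynomial.eval_X, Polynomial.eval_C] at h1
    obtain ⟨σ, -, hσ⟩ := Finset.prod_eq_zero_iff.mp h1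
    exact ⟨σ, sub_eq_zero.mp hσ⟩
  -- So far `σ` depends on `g`. A vector space over an infinite field is not a finite union of
  -- proper subspaces, so one `σ` serves all `g`.
  let V : G → Subspace K A := fun σ =>
    LinearMap.eqLocus i₂.toLinearMap (i₁.comp (θ σ)).toLinearMap
  have hV : ∃ σ, V σ = ⊤ := by
    by_contra! hne
    have hcov := Subspace.biUnion_ne_univ_of_top_notMem (s := Finset.univ.image V)
      (by simpa using hne)
    refine hcov (Set.eq_univ_of_forall fun g => ?_)
    obtain ⟨σ, hσ⟩ := hroot g
    simp only [Finset.mem_image, Finset.mem_univ, true_and, Set.iUnion_exists, Set.mem_iUnion]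
    exact ⟨V σ, σ, rfl, hσ⟩
  obtain ⟨σ, hσ⟩ := hV
  refine ⟨σ, ker_graphHom_le fun g => Ideal.Quotient.eq.mp ?_⟩
  have : g ∈ V σ := hσ ▸ Submodule.mem_top
  exact this

end Graph

/-! ### Irreducible closed subsets and primes of the coordinate ring -/

namespace AffineVariety

section Coordinate

variable {K : Type u} [Field K] {m : ℕ} {𝔞 : Ideal (MvPolynomial (Fin m) K)}

@[ext]
lemma CoordinateRing.ext {f g : CoordinateRing 𝔞} (h : ∀ x, f.1 x = g.1 x) : f = g :=
  Subtype.ext (funext h)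

lemma isClosed_iff_exists_zeros {Z : Set (AffineVariety 𝔞)} :
    IsClosed Z ↔ ∃ S, Z = zeros 𝔞 S := by
  rw [← isOpen_compl_iff]
  change Zᶜᶜ ∈ _ ↔ _
  rw [compl_compl]
  rfl

variable (𝔞) in
/-- The regular function given by a polynomial. -/
noncomputable def ofPolynomial : MvPolynomial (Fin m) K →ₐ[K] CoordinateRing 𝔞 :=
  (AlgHom.pi fun x : AffineVariety 𝔞 =>
    (MvPolynomial.aeval x.1 : MvPolynomial (Fin m) K →ₐ[K] K)).rangeRestrict

lemma ofPolynomial_apply (p : MvPolynomial (Fin m) K) (x : AffineVariety 𝔞) :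
    (ofPolynomial 𝔞 p).1 x = MvPolynomial.eval x.1 p := rfl

lemma ofPolynomial_surjective : Function.Surjective (ofPolynomial 𝔞) :=
  AlgHom.rangeRestrict_surjective _

instance : Algebra.FiniteType K (CoordinateRing 𝔞) :=
  Algebra.FiniteType.of_surjective (ofPolynomial 𝔞) ofPolynomial_surjective

/-- Evaluation of regular functions at a point. -/
noncomputable def evalHom (x : AffineVariety 𝔞) : CoordinateRing 𝔞 →ₐ[K] K :=
  (Pi.evalAlgHom K (fun _ : AffineVariety 𝔞 => K) x).comp (regularFunctions 𝔞).val

lemma evalHom_apply (x : AffineVariety 𝔞) (f : CoordinateRing 𝔞) : evalHom x f = f.1 x := rfl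

/-- The pullback of regular functions along a regular map. -/
noncomputable def pullback {φ : AffineVariety 𝔞 → AffineVariety 𝔞} (hφ : IsRegularMap φ) :
    CoordinateRing 𝔞 →ₐ[K] CoordinateRing 𝔞 :=
  AlgHom.codRestrict (AlgHom.pi fun x => evalHom (φ x)) (regularFunctions 𝔞) <| by
    obtain ⟨P, hP⟩ := hφ
    intro f
    obtain ⟨p, rfl⟩ := ofPolynomial_surjective f
    refine ⟨MvPolynomial.aeval P p, funext fun x => ?_⟩
    change MvPolynomial.eval x.1 (MvPolynomial.aeval P p) = MvPolynomial.eval (φ x).1 p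
    rw [MvPolynomial.aeval_def, MvPolynomial.algebraMap_eq, MvPolynomial.eval_eval₂,
      funext (hP x), ← MvPolynomial.eval₂_id]
    congr 1
    ext; simp

lemma pullback_apply {φ : AffineVariety 𝔞 → AffineVariety 𝔞} (hφ : IsRegularMap φ)
    (f : CoordinateRing 𝔞) (x : AffineVariety 𝔞) : (pullback hφ f).1 x = f.1 (φ x) := rfl

/-- The ideal of regular functions vanishing on a set of points. -/
noncomputable def functionIdeal (Z : Set (AffineVariety 𝔞)) : Ideal (CoordinateRing 𝔞) :=
  ⨅ x ∈ Z, RingHom.ker (evalHom x)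

lemma mem_functionIdeal {Z : Set (AffineVariety 𝔞)} {f : CoordinateRing 𝔞} :
    f ∈ functionIdeal Z ↔ ∀ x ∈ Z, f.1 x = 0 := by
  simp [functionIdeal, RingHom.mem_ker, evalHom_apply]

lemma mul_apply (f g : CoordinateRing 𝔞) (x : AffineVariety 𝔞) :
    (f * g).1 x = f.1 x * g.1 x := rfl

/-- The points at which all elements of an ideal of regular functions vanish. -/
def locus (q : Ideal (CoordinateRing 𝔞)) : Set (AffineVariety 𝔞) :=
  {x | ∀ f ∈ q, f.1 x = 0}

lemma isClosed_locus (q : Ideal (CoordinateRing 𝔞)) : IsClosed (locus q) := by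
  refine isClosed_iff_exists_zeros.mpr ⟨ofPolynomial 𝔞 ⁻¹' q, ?_⟩
  ext x
  exact ⟨fun hx p hp => hx _ hp, fun hx f hf => by
    obtain ⟨p, rfl⟩ := ofPolynomial_surjective f
    exact hx p hf⟩

lemma locus_functionIdeal {Z : Set (AffineVariety 𝔞)} (hZ : IsClosed Z) :
    locus (functionIdeal Z) = Z := by
  obtain ⟨S, rfl⟩ := isClosed_iff_exists_zeros.mp hZ
  refine Set.Subset.antisymm (fun x hx p hp => ?_) fun x hx f hf => mem_functionIdeal.mp hf x hx
  exact hx (ofPolynomial 𝔞 p) (mem_functionIdeal.mpr fun y hy => hy p hp)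

lemma functionIdeal_isPrime {Z : Set (AffineVariety 𝔞)} (hZ : IsIrreducible Z) :
    (functionIdeal Z).IsPrime := by
  refine ⟨(Ideal.ne_top_iff_one _).mpr fun h => ?_, fun {f g} hfg => ?_⟩
  · obtain ⟨x, hx⟩ := hZ.1
    exact one_ne_zero (mem_functionIdeal.mp h x hx)
  · have := isPreirreducible_iff_isClosed_union_isClosed.mp hZ.2 (locus (Ideal.span {f}))
      (locus (Ideal.span {g})) (isClosed_locus _) (isClosed_locus _) ?_
    · exact this.imp
        (fun h => mem_functionIdeal.mpr fun x hx => h hx f (Ideal.mem_span_singleton_self f))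
        (fun h => mem_functionIdeal.mpr fun x hx => h hx g (Ideal.mem_span_singleton_self g))
    · intro x hx
      have hmul := mem_functionIdeal.mp hfg x hx
      rw [mul_apply] at hmul
      refine (mul_eq_zero.mp hmul).imp (fun h t ht => ?_) (fun h t ht => ?_) <;>
      · obtain ⟨c, rfl⟩ := Ideal.mem_span_singleton'.mp ht
        rw [mul_apply, h, mul_zero]

/-- The Nullstellensatz for prime ideals of the coordinate ring. -/
lemma functionIdeal_locus [IsAlgClosed K] (q : Ideal (CoordinateRing 𝔞)) [hq : q.IsPrime] :
    functionIdeal (locus q) = q := by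
  refine le_antisymm (fun f hf => ?_) fun f hf => mem_functionIdeal.mpr fun x hx => hx f hf
  obtain ⟨p, rfl⟩ := ofPolynomial_surjective f
  change p ∈ q.comap (ofPolynomial 𝔞)
  rw [← MvPolynomial.IsPrime.vanishingIdeal_zeroLocus (K := K) (q.comap (ofPolynomial 𝔞))]
  intro x hx
  have hx𝔞 : x ∈ MvPolynomial.zeroLocus K 𝔞 := fun r hr => hx r <| by
    have : ofPolynomial 𝔞 r = 0 := CoordinateRing.ext fun y => y.2 r hr
    rw [Ideal.mem_comap, this]
    exact q.zero_mem
  refine mem_functionIdeal.mp hf ⟨x, hx𝔞⟩ fun g hg => ?_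
  obtain ⟨r, rfl⟩ := ofPolynomial_surjective g
  exact hx r hg

lemma isIrreducible_locus [IsAlgClosed K] (q : Ideal (CoordinateRing 𝔞)) [hq : q.IsPrime] :
    IsIrreducible (locus q) := by
  refine ⟨Set.nonempty_iff_ne_empty.mpr fun h => hq.ne_top ?_,
    isPreirreducible_iff_isClosed_union_isClosed.mpr fun Z₁ Z₂ h₁ h₂ h => ?_⟩
  · rw [← functionIdeal_locus q, h]
    simp [functionIdeal]
  · have hmul : functionIdeal Z₁ * functionIdeal Z₂ ≤ q := by
      refine Ideal.mul_le.mpr fun f hf g hg => ?_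
      rw [← functionIdeal_locus q, mem_functionIdeal]
      intro x hx
      rw [mul_apply]
      exact mul_eq_zero.mpr
        ((h hx).imp (mem_functionIdeal.mp hf x) (mem_functionIdeal.mp hg x))
    refine (hq.mul_le.mp hmul).imp (fun h x hx => ?_) (fun h x hx => ?_)
    · rw [← locus_functionIdeal h₁]
      exact fun f hf => hx f (h hf)
    · rw [← locus_functionIdeal h₂]
      exact fun f hf => hx f (h hf)

/-- Vanishing ideals followed by `comap π` turn chains of irreducible closed sets above `locus q`
into strict chains of primes below `q.comap π`. -/
lemma topologicalCodim_le_height_comap [IsAlgClosed K] {S : Type*} [CommRing S]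
    {π : S →+* CoordinateRing 𝔞} (hπ : Function.Surjective π) (q : Ideal (CoordinateRing 𝔞))
    [hq : q.IsPrime] {Z : Set (AffineVariety 𝔞)} (hZ : locus q ⊆ Z) :
    topologicalCodim Z ≤ (q.comap π).height := by
  let W : TopologicalSpace.IrreducibleCloseds (AffineVariety 𝔞) :=
    ⟨locus q, isIrreducible_locus q, isClosed_locus q⟩
  let F : TopologicalSpace.IrreducibleCloseds (AffineVariety 𝔞) → (PrimeSpectrum S)ᵒᵈ := fun W =>
    OrderDual.toDual (PrimeSpectrum.comap π ⟨functionIdeal W, functionIdeal_isPrime W.2⟩)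
  have hF : StrictMono F := by
    refine Monotone.strictMono_of_injective (fun W₁ W₂ h => ?_) fun W₁ W₂ h => ?_
    · refine Ideal.comap_mono (f := π) fun f hf => ?_
      exact mem_functionIdeal.mpr fun x hx => mem_functionIdeal.mp hf x (h hx)
    · have h' := PrimeSpectrum.comap_injective_of_surjective π hπ (OrderDual.toDual.injective h)
      have h'' : functionIdeal (W₁ : Set (AffineVariety 𝔞)) = functionIdeal W₂ :=
        congrArg PrimeSpectrum.asIdeal h'
      refine TopologicalSpace.IrreducibleCloseds.ext ?_
      rw [← locus_functionIdeal W₁.isClosed, h'', locus_functionIdeal W₂.isClosed]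
  have hle := Order.coheight_le_coheight_apply_of_strictMono F hF W
  have hFW : F W = OrderDual.toDual ⟨q.comap π, hq.comap π⟩ :=
    congrArg OrderDual.toDual (PrimeSpectrum.ext (congrArg (Ideal.comap π) (functionIdeal_locus q)))
  rw [hFW, Order.coheight_toDual, ← PrimeSpectrum.height_eq_orderHeight] at hle
  exact (iInf₂_le W hZ).trans hle

end Coordinate

end AffineVariety

lemma exists_ringKrullDim_le_of_finiteType (K : Type*) {A : Type*} [Field K] [CommRing A]
    [Algebra K A] [hA : Algebra.FiniteType K A] : ∃ n : ℕ, ringKrullDim A ≤ n := by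
  obtain ⟨n, f, hf⟩ := Algebra.FiniteType.iff_quotient_mvPolynomial''.mp hA
  refine ⟨n, (ringKrullDim_le_of_surjective f.toRingHom hf).trans ?_⟩
  simp

lemma Ideal.IsPrime.exists_le_of_iInf_le {R ι : Type*} [CommRing R] [Finite ι] {f : ι → Ideal R}
    {p : Ideal R} (hp : p.IsPrime) (h : ⨅ i, f i ≤ p) : ∃ i, f i ≤ p := by
  cases nonempty_fintype ι
  rw [← Finset.inf_univ_eq_iInf, hp.inf_le'] at h
  simpa using h

/-! ### The graphs of the group elements in the spectrum of `R/J` -/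

namespace AffineVariety

instance {K : Type u} [Field K] {m : ℕ} {𝔞 : Ideal (MvPolynomial (Fin m) K)} :
    Algebra.FiniteType K (CoordinateRing 𝔞 ⊗[K] CoordinateRing 𝔞) :=
  Algebra.FiniteType.trans (S := CoordinateRing 𝔞) inferInstance inferInstance

section Action

variable {K : Type u} [Field K] {m : ℕ} {𝔞 : Ideal (MvPolynomial (Fin m) K)}
  {G : Type v} [Group G] [MulAction G (AffineVariety 𝔞)]

lemma separatingIdeal_le_ker
    (hreg : ∀ σ : G, IsRegularMap (fun x : AffineVariety 𝔞 => σ • x)) (σ : G) :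
    separatingIdeal G 𝔞 ≤ RingHom.ker (graphHom (pullback (hreg σ))) := by
  refine Ideal.span_le.mpr ?_
  rintro _ ⟨f, hf, rfl⟩
  rw [SetLike.mem_coe, RingHom.mem_ker, map_sub, graphHom_tmul, graphHom_tmul, map_one, mul_one,
    one_mul, sub_eq_zero]
  exact CoordinateRing.ext fun x => (hf σ x).symm

lemma exists_ker_le_of_separatingIdeal_le [IsAlgClosed K] [Finite G]
    (hreg : ∀ σ : G, IsRegularMap (fun x : AffineVariety 𝔞 => σ • x))
    {p : Ideal (CoordinateRing 𝔞 ⊗[K] CoordinateRing 𝔞)} [p.IsPrime]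
    (hp : separatingIdeal G 𝔞 ≤ p) :
    ∃ σ : G, RingHom.ker (graphHom (pullback (hreg σ))) ≤ p := by
  have : Infinite K := IsAlgClosed.instInfinite
  refine exists_ker_graphHom_le (θ := fun σ => pullback (hreg σ)) ?_ ?_ fun f hf => ?_
  · ext f x
    rw [pullback_apply, one_smul, AlgHom.id_apply]
  · intro σ τ g
    ext x
    simp only [pullback_apply, mul_smul]
  · refine hp (Ideal.subset_span ⟨f, fun σ x => ?_, rfl⟩)
    conv_rhs => rw [← hf σ]
    rw [pullback_apply]

/-- The homomorphism to the coordinate ring of the graph of `σ`, on a quotient by an ideal with the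
radical of the separating ideal. -/
noncomputable def graphQuotientHom
    (hreg : ∀ σ : G, IsRegularMap (fun x : AffineVariety 𝔞 => σ • x))
    {J : Ideal (CoordinateRing 𝔞 ⊗[K] CoordinateRing 𝔞)}
    (hJ : J ≤ (separatingIdeal G 𝔞).radical) (σ : G) :
    (CoordinateRing 𝔞 ⊗[K] CoordinateRing 𝔞) ⧸ J →+* CoordinateRing 𝔞 :=
  Ideal.Quotient.lift J (graphHom (pullback (hreg σ))).toRingHom fun r hr => by
    -- A power of `r` dies on the graph, hence so does `r`, because values of regular functions lie
    -- in a field.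
    obtain ⟨n, hn⟩ := hJ hr
    ext x
    have h := congrArg (fun f => evalHom x f)
      (RingHom.mem_ker.mp (separatingIdeal_le_ker hreg σ hn))
    simp only [map_pow, map_zero] at h
    exact eq_zero_of_pow_eq_zero h

section Quotient

variable (hreg : ∀ σ : G, IsRegularMap (fun x : AffineVariety 𝔞 => σ • x))
  {J : Ideal (CoordinateRing 𝔞 ⊗[K] CoordinateRing 𝔞)}
  (hJ : J ≤ (separatingIdeal G 𝔞).radical)

lemma graphQuotientHom_mk (σ : G) (r : CoordinateRing 𝔞 ⊗[K] CoordinateRing 𝔞) :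
    graphQuotientHom hreg hJ σ (Ideal.Quotient.mk J r) = graphHom (pullback (hreg σ)) r := rfl

lemma graphQuotientHom_surjective (σ : G) :
    Function.Surjective (graphQuotientHom hreg hJ σ) := fun f => by
  obtain ⟨r, rfl⟩ := graphHom_surjective (pullback (hreg σ)) f
  exact ⟨Ideal.Quotient.mk J r, rfl⟩

/-- Both sides are the value of `s` at the common point `(x, σ • x) = (x, τ • x)` of the two graphs.
-/
lemma evalHom_graphQuotientHom_eq {σ τ : G} {x : AffineVariety 𝔞} (h : σ • x = τ • x)
    (s : (CoordinateRing 𝔞 ⊗[K] CoordinateRing 𝔞) ⧸ J) :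
    evalHom x (graphQuotientHom hreg hJ σ s) = evalHom x (graphQuotientHom hreg hJ τ s) := by
  obtain ⟨r, rfl⟩ := Ideal.Quotient.mk_surjective s
  simp only [graphQuotientHom_mk]
  induction r with
  | zero => simp only [map_zero]
  | tmul f g =>
    simp only [graphHom_tmul, map_mul, evalHom_apply, pullback_apply, h]
  | add r s hr hs => simp only [map_add, hr, hs]

lemma exists_ker_graphQuotientHom_le [IsAlgClosed K] [Finite G] (hIJ : separatingIdeal G 𝔞 ≤ J.radical)
    (p : Ideal ((CoordinateRing 𝔞 ⊗[K] CoordinateRing 𝔞) ⧸ J)) [hp : p.IsPrime] :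
    ∃ σ : G, RingHom.ker (graphQuotientHom hreg hJ σ) ≤ p := by
  have hle : separatingIdeal G 𝔞 ≤ p.comap (Ideal.Quotient.mk J) := by
    refine hIJ.trans ((hp.comap _).radical_le_iff.mpr fun r hr => ?_)
    rw [Ideal.mem_comap, Ideal.Quotient.eq_zero_iff_mem.mpr hr]
    exact p.zero_mem
  have := hp.comap (Ideal.Quotient.mk J)
  obtain ⟨σ, hσ⟩ := exists_ker_le_of_separatingIdeal_le hreg hle
  refine ⟨σ, fun s hs => ?_⟩
  obtain ⟨r, rfl⟩ := Ideal.Quotient.mk_surjective s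
  exact hσ hs

/-- A point of the intersection of two graphs has at least the codimension of the fixed locus. -/
lemma topologicalCodim_fixedBy_le [IsAlgClosed K] {σ τ : G}
    (p : Ideal ((CoordinateRing 𝔞 ⊗[K] CoordinateRing 𝔞) ⧸ J)) [hp : p.IsPrime]
    (hσ : RingHom.ker (graphQuotientHom hreg hJ σ) ≤ p)
    (hτ : RingHom.ker (graphQuotientHom hreg hJ τ) ≤ p) :
    ∃ q : Ideal (CoordinateRing 𝔞), q.IsPrime ∧ q.comap (graphQuotientHom hreg hJ σ) = p ∧
      topologicalCodim (MulAction.fixedBy (AffineVariety 𝔞) (σ⁻¹ * τ)) ≤ q.height ∧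
      topologicalCodim (MulAction.fixedBy (AffineVariety 𝔞) (σ⁻¹ * τ)) ≤ p.height := by
  have hsurj := graphQuotientHom_surjective hreg hJ σ
  let q := p.map (graphQuotientHom hreg hJ σ)
  have hq : q.IsPrime := Ideal.map_isPrime_of_surjective hsurj hσ
  have hqp : q.comap (graphQuotientHom hreg hJ σ) = p := by
    rw [Ideal.comap_map_of_surjective' _ hsurj, sup_eq_left.mpr hσ]
  have hlocus : locus q ⊆ MulAction.fixedBy (AffineVariety 𝔞) (σ⁻¹ * τ) := by
    intro x hx
    rw [MulAction.mem_fixedBy, mul_smul, inv_smul_eq_iff]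
    refine Subtype.ext (funext fun i => ?_)
    let g : CoordinateRing 𝔞 := ofPolynomial 𝔞 (MvPolynomial.X i)
    have hg : ∀ y : AffineVariety 𝔞, g.1 y = y.1 i := fun y => by
      rw [ofPolynomial_apply, MvPolynomial.eval_X]
    -- This vanishes on the graph of `τ`, while on the graph of `σ` it is the difference of the
    -- `i`-th coordinates of `σ • x` and `τ • x`.
    let r : CoordinateRing 𝔞 ⊗[K] CoordinateRing 𝔞 :=
      1 ⊗ₜ[K] g - pullback (hreg τ) g ⊗ₜ[K] 1
    have hr : Ideal.Quotient.mk J r ∈ p := hτ <| by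
      rw [RingHom.mem_ker, graphQuotientHom_mk]
      simp [r]
    have h0 := hx _ (Ideal.mem_map_of_mem (graphQuotientHom hreg hJ σ) hr)
    rw [graphQuotientHom_mk, ← evalHom_apply] at h0
    simp only [r, map_sub, graphHom_tmul, map_one, one_mul, mul_one, evalHom_apply,
      pullback_apply, hg] at h0
    exact (sub_eq_zero.mp h0).symm
  refine ⟨q, hq, hqp, ?_, ?_⟩
  · simpa using! topologicalCodim_le_height_comap (π := RingHom.id _) Function.surjective_id q hlocus
  · rw [← hqp]
    exact topologicalCodim_le_height_comap hsurj q hlocus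

/-- The intersection of the two graphs has positive codimension in the graph of `σ`, so `p` is not a
generic point of that graph. -/
lemma exists_prime_lt [IsAlgClosed K] {σ τ : G} {k : ℕ}
    (hk : ¬ IsKReflection (AffineVariety 𝔞) k (σ⁻¹ * τ))
    {p : Ideal ((CoordinateRing 𝔞 ⊗[K] CoordinateRing 𝔞) ⧸ J)} [hp : p.IsPrime]
    (hσ : RingHom.ker (graphQuotientHom hreg hJ σ) ≤ p)
    (hτ : RingHom.ker (graphQuotientHom hreg hJ τ) ≤ p) :
    ∃ p' : Ideal ((CoordinateRing 𝔞 ⊗[K] CoordinateRing 𝔞) ⧸ J), p'.IsPrime ∧ p' < p ∧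
      RingHom.ker (graphQuotientHom hreg hJ σ) ≤ p' := by
  obtain ⟨q, hq, hqp, hqh, -⟩ := topologicalCodim_fixedBy_le hreg hJ p hσ hτ
  have h0 : Order.height (⟨q, hq⟩ : PrimeSpectrum (CoordinateRing 𝔞)) ≠ 0 := by
    rw [← PrimeSpectrum.height_eq_orderHeight]
    exact (lt_of_le_of_lt zero_le ((not_le.mp hk).trans_le hqh)).ne'
  rw [Ne, Order.height_eq_zero, not_isMin_iff] at h0
  obtain ⟨q', hq'⟩ := h0
  refine ⟨q'.asIdeal.comap (graphQuotientHom hreg hJ σ), q'.2.comap _, ?_, fun s hs => ?_⟩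
  · rw [← hqp]
    refine lt_of_le_of_ne (Ideal.comap_mono hq'.le) fun h => hq'.ne ?_
    exact PrimeSpectrum.ext
      (Ideal.comap_injective_of_surjective _ (graphQuotientHom_surjective hreg hJ σ) h)
  · rw [Ideal.mem_comap, RingHom.mem_ker.mp hs]
    exact q'.asIdeal.zero_mem

end Quotient

/-- Elements with a fixed point lie in every subgroup containing all `(k + 1)`-reflections. -/
lemma mem_of_cmDefect_le [IsAlgClosed K] [Finite G]
    (hreg : ∀ σ : G, IsRegularMap (fun x : AffineVariety 𝔞 => σ • x))
    {J : Ideal (CoordinateRing 𝔞 ⊗[K] CoordinateRing 𝔞)}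
    (hJ : J ≤ (separatingIdeal G 𝔞).radical) (hIJ : separatingIdeal G 𝔞 ≤ J.radical) {k : ℕ}
    (hk : cmDefect ((CoordinateRing 𝔞 ⊗[K] CoordinateRing 𝔞) ⧸ J) ≤ k) {N : Subgroup G}
    (hN : ∀ σ : G, IsKReflection (AffineVariety 𝔞) (k + 1) σ → σ ∈ N) {ρ : G}
    {x : AffineVariety 𝔞} (hx : ρ • x = x) : ρ ∈ N := by
  by_contra hρ
  have : IsNoetherianRing (CoordinateRing 𝔞 ⊗[K] CoordinateRing 𝔞) :=
    Algebra.FiniteType.isNoetherianRing K _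
  let π := graphQuotientHom hreg hJ
  let a : Ideal ((CoordinateRing 𝔞 ⊗[K] CoordinateRing 𝔞) ⧸ J) :=
    ⨅ σ : {σ : G // σ ∈ N}, RingHom.ker (π σ)
  let b : Ideal ((CoordinateRing 𝔞 ⊗[K] CoordinateRing 𝔞) ⧸ J) :=
    ⨅ σ : {σ : G // σ ∉ N}, RingHom.ker (π σ)
  have ha : ∀ σ ∈ N, a ≤ RingHom.ker (π σ) := fun σ hσ =>
    iInf_le (fun σ : {σ : G // σ ∈ N} => RingHom.ker (π σ)) ⟨σ, hσ⟩
  have hb : ∀ σ ∉ N, b ≤ RingHom.ker (π σ) := fun σ hσ =>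
    iInf_le (fun σ : {σ : G // σ ∉ N} => RingHom.ker (π σ)) ⟨σ, hσ⟩
  have hab : a * b ≤ nilradical _ := by
    rw [nilradical_eq_sInf]
    refine le_sInf fun P (hP : P.IsPrime) => ?_
    obtain ⟨σ, hσ⟩ := exists_ker_graphQuotientHom_le hreg hJ hIJ P
    by_cases hσN : σ ∈ N
    · exact Ideal.mul_le_left.trans ((ha σ hσN).trans hσ)
    · exact Ideal.mul_le_right.trans ((hb σ hσN).trans hσ)
  -- All of `a ⊔ b` vanishes at `(x, x)`, which lies on the graphs of `1 ∈ N` and `ρ ∉ N`.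
  have hne : a ⊔ b ≠ ⊤ := by
    intro h
    have hle : a ⊔ b ≤ (RingHom.ker (evalHom x)).comap (π 1) := by
      refine sup_le (fun s hs => ?_) fun s hs => ?_
      · rw [Ideal.mem_comap, RingHom.mem_ker.mp (ha 1 N.one_mem hs)]
        exact Ideal.zero_mem _
      · rw [Ideal.mem_comap, RingHom.mem_ker,
          evalHom_graphQuotientHom_eq hreg hJ (show (1 : G) • x = ρ • x by rw [one_smul, hx]),
          RingHom.mem_ker.mp (hb ρ hρ hs), map_zero]
    exact ((RingHom.ker_isPrime (evalHom x)).comap (π 1)).ne_top (top_le_iff.mp (h ▸ hle))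
  obtain ⟨p, hp⟩ := Ideal.nonempty_minimalPrimes hne
  have hpp : p.IsPrime := hp.1.1
  obtain ⟨⟨σ, hσN⟩, hσ⟩ := hpp.exists_le_of_iInf_le (le_sup_left.trans hp.1.2 : a ≤ p)
  obtain ⟨⟨τ, hτN⟩, hτ⟩ := hpp.exists_le_of_iInf_le (le_sup_right.trans hp.1.2 : b ≤ p)
  have hστ : ¬ IsKReflection (AffineVariety 𝔞) (k + 1) (σ⁻¹ * τ) := fun h =>
    hτN ((N.mul_mem_cancel_left (N.inv_mem hσN)).mp (hN _ h))
  have hτσ : ¬ IsKReflection (AffineVariety 𝔞) (k + 1) (τ⁻¹ * σ) := fun h =>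
    hτN (N.inv_mem_iff.mp ((N.mul_mem_cancel_right hσN).mp (hN _ h)))
  obtain ⟨-, -, -, -, hph⟩ := topologicalCodim_fixedBy_le hreg hJ p hσ hτ
  have hht : ((k + 2 : ℕ) : ℕ∞) ≤ p.height := by
    have := Order.add_one_le_of_lt ((not_le.mp hστ).trans_le hph)
    exact_mod_cast this
  -- If `a` lies in all primes below `p`, a smaller prime on the graph of `τ` contains both `a` and
  -- `b`, against the minimality of `p`; the other case uses the graph of `σ`.
  rcases forall_prime_le_of_cmDefect_le hk hab hp hht with h | h
  · obtain ⟨p', hp', hlt, hker⟩ := exists_prime_lt hreg hJ hτσ hτ hσ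
    exact hlt.not_ge (hp.2 ⟨hp', sup_le (h p' hp' hlt.le) ((hb τ hτN).trans hker)⟩ hlt.le)
  · obtain ⟨p', hp', hlt, hker⟩ := exists_prime_lt hreg hJ hστ hσ hτ
    exact hlt.not_ge (hp.2 ⟨hp', sup_le ((ha σ hσN).trans hker) (h p' hp' hlt.le)⟩ hlt.le)

end Action

end AffineVariety

theorem theorem3p1 {K : Type u} [Field K] [IsAlgClosed K] {m : ℕ}
    (𝔞 : Ideal (MvPolynomial (Fin m) K))
    {G : Type v} [Group G] [Finite G] [MulAction G (AffineVariety 𝔞)]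
    (hreg : ∀ σ : G, AffineVariety.IsRegularMap (fun x : AffineVariety 𝔞 => σ • x))
    (hconn : ConnectedSpace (AffineVariety 𝔞))
    (hfix : Subgroup.closure {σ : G | ∃ x : AffineVariety 𝔞, σ • x = x} = ⊤) :
    ∃ k : ℕ,
      IsLeast (cmDefectsUpToRadical (AffineVariety.separatingIdeal G 𝔞)) (k : ℕ∞) ∧
      Subgroup.closure {σ : G | IsKReflection (AffineVariety 𝔞) (k + 1) σ} = ⊤ := by
  let I := AffineVariety.separatingIdeal G 𝔞
  have hmem : cmDefect (_ ⧸ I) ∈ cmDefectsUpToRadical I := ⟨I, rfl, rfl⟩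
  obtain ⟨n, hn⟩ := exists_ringKrullDim_le_of_finiteType K
    (A := (AffineVariety.CoordinateRing 𝔞 ⊗[K] AffineVariety.CoordinateRing 𝔞) ⧸ I)
  have hleast : IsLeast (cmDefectsUpToRadical I) (sInf (cmDefectsUpToRadical I)) :=
    ⟨csInf_mem ⟨_, hmem⟩, fun d hd => sInf_le hd⟩
  -- The choice `J = I` already has finite defect, bounded by the dimension of a finitely generated
  -- algebra.
  have hfin : sInf (cmDefectsUpToRadical I) ≠ ⊤ :=
    ne_top_of_le_ne_top (ENat.natCast_ne_top n)
      ((sInf_le hmem).trans (cmDefect_le_of_ringKrullDim_le hn))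
  obtain ⟨k, hk⟩ := ENat.ne_top_iff_exists.mp hfin
  rw [← hk] at hleast
  refine ⟨k, hleast, ?_⟩
  obtain ⟨J, hJ, hJk⟩ := hleast.1
  rw [eq_top_iff, ← hfix, Subgroup.closure_le]
  rintro ρ ⟨x, hx⟩
  exact AffineVariety.mem_of_cmDefect_le hreg (hJ ▸ Ideal.le_radical)
    (hJ.symm ▸ Ideal.le_radical) hJk.ge (fun σ hσ => Subgroup.subset_closure hσ) hx
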